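/- Let $\mathcal H$ be a complex Hilbert space and let $T,T'$ be contractions on $\mathcal H$. We say that $T$ is Harnack dominated by $T'$, written $T\stackrel{\rm H}{\prec}T'$, if there is a constant $c\ge 1$ such that $\Re p(T)\le c\,\Re p(T')$ for every polynomial $p\in\mathbb C[z]$ with $\Re p(z)\ge 0$ for all $|z|\le 1$, where $\Re A=\frac12(A+A^*)$; and that $T$ and $T'$ are Harnack equivalent if $T\stackrel{\rm H}{\prec}T'$ and $T'\stackrel{\rm H}{\prec}T$. Write $\mathcal N(A)$ for the kernel of $A$, $D_{T'}=(I-T'^*T')^{1/2}$, and $S_T$ for the strong limit of $(T^{*n}T^n)_{n}$. A closed subspace reduces $T$ if it is invariant for $T$ and $T^*$. Let $\mathcal H_i$ (respectively $\mathcal H_i'$) be the largest closed subspace reducing $T$ (respectively $T'$) on which $T$ (respectively $T'$) is an isometry. A minimal isometric dilation of $T$ is an isometry $V$ on a Hilbert space $\mathcal K\supset\mathcal H$ with $\mathcal K=\bigvee_{n\ge0}V^n\mathcal H$ and $P_{\mathcal H}V=TP_{\mathcal H}$. If $T\stackrel{\rm H}{\prec}T'$ and $V$ on $\mathcal K$,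 $V'$ on $\mathcal K'$ are minimal isometric dilations of $T$, $T'$, the Harnack operator associated to $(T,T')$ is the unique bounded operator $A:\mathcal K'\to\mathcal K$ with $A|_{\mathcal H}=I_{\mathcal H}$ and $AV'=VA$. **Theorem.** Suppose that $TT'=T'T$ and that $T\stackrel{\rm H}{\prec}T'$. Then: (i) $\mathcal H_i'\subset\mathcal H_i$ and $T'=T$ on $\mathcal H_i'$. (ii) If $\mathcal H_i\subset\mathcal N(D_{T'})$, then $\mathcal H_i'$ reduces $T$. If $\mathcal N(I-S_T)$ reduces $T'$, then $$\mathcal H_i=\mathcal H_i'=\mathcal N(I-S_{T'})=\mathcal N(I-S_T).$$ (iii) If the Harnack operator associated to $(T,T')$ is injective, then $\mathcal H_i'$ reduces $T$. (iv) If $T$ and $T'$ are Harnack equivalent, then $\mathcal H_i=\mathcal H_i'$. -/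

import Mathlib

open Filter Topology
open scoped InnerProduct ComplexStarModule

universe u v w

noncomputable section

namespace HarnackParts

section Operators

variable {H : Type u} [NormedAddCommGroup H] [InnerProductSpace ℂ H] [CompleteSpace H]

/-- `T` is Harnack dominated by `T'`: there is a constant `c ≥ 1` such that
`Re p(T) ≤ c Re p(T')` (Loewner order) for every analytic polynomial `p` with `Re p(z) ≥ 0`
on the closed unit disc. Here `ℜ A = (1/2)(A + A*)`. -/
def HarnackDominated (T T' : H →L[ℂ] H) : Prop :=
  ∃ c : ℝ, 1 ≤ c ∧ ∀ p : Polynomial ℂ, (∀ z : ℂ, ‖z‖ ≤ 1 → 0 ≤ (p.eval z).re) →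
    (ℜ (Polynomial.aeval T p) : H →L[ℂ] H) ≤ c • (ℜ (Polynomial.aeval T' p) : H →L[ℂ] H)

/-- `T` and `T'` are Harnack equivalent (belong to the same Harnack part). -/
def HarnackEquivalent (T T' : H →L[ℂ] H) : Prop :=
  HarnackDominated T T' ∧ HarnackDominated T' T

/-- The defect operator `D_T = (I - T* T)^{1/2}`. -/
def defect (T : H →L[ℂ] H) : H →L[ℂ] H :=
  CFC.sqrt (1 - T† * T)

/-- `S` is the strong limit of the sequence `T*ⁿ Tⁿ`. -/
def IsStrongLimit (T S : H →L[ℂ] H) : Prop :=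
  ∀ x : H, Tendsto (fun n : ℕ => ((T†) ^ n * T ^ n) x) atTop (𝓝 (S x))

open Classical in
/-- The asymptotic limit `S_T`, the strong limit of `T*ⁿ Tⁿ` (which exists for every
contraction, see `isStrongLimit_asymptoticLimit`; the value is `0` if there is no limit). -/
def asymptoticLimit (T : H →L[ℂ] H) : H →L[ℂ] H :=
  if h : ∃ S, IsStrongLimit T S then h.choose else 0

/-- A closed subspace `M` reduces `T` if it is invariant for `T` and for `T*`. -/
def Reduces (M : Submodule ℂ H) (T : H →L[ℂ] H) : Prop :=
  IsClosed (M : Set H) ∧ (∀ x ∈ M, T x ∈ M) ∧ ∀ x ∈ M, (T†) x ∈ M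

/-- `M` is a reducing subspace for `T` on which `T` is an isometry. -/
def IsReducingIsometric (T : H →L[ℂ] H) (M : Submodule ℂ H) : Prop :=
  Reduces M T ∧ ∀ x ∈ M, ‖T x‖ = ‖x‖

/-- The reducing isometric part of `T`: the closed linear span of all reducing subspaces on which
`T` is an isometry. By `isGreatest_reducingIsometricPart` it is the maximal (that is, the largest)
reducing subspace on which `T` is an isometry. -/
def reducingIsometricPart (T : H →L[ℂ] H) : Submodule ℂ H :=
  (sSup {M : Submodule ℂ H | IsReducingIsometric T M}).topologicalClosure

theorem isGreatest_reducingIsometricPart (T : H →L[ℂ] H) :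
    IsGreatest {M : Submodule ℂ H | IsReducingIsometric T M} (reducingIsometricPart T) := by
  have hmap : ∀ R : H →L[ℂ] H, (∀ M : Submodule ℂ H, IsReducingIsometric T M → ∀ x ∈ M, R x ∈ M) →
      ∀ x ∈ reducingIsometricPart T, R x ∈ reducingIsometricPart T := by
    intro R hR x hx
    have h1 : sSup {M : Submodule ℂ H | IsReducingIsometric T M} ≤
        (sSup {M : Submodule ℂ H | IsReducingIsometric T M}).comap (R : H →ₗ[ℂ] H) := by
      refine sSup_le fun M hM y hy => ?_
      exact (le_sSup (a := M) hM) (hR M hM y hy)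
    exact map_mem_closure R.continuous hx fun y hy => h1 hy
  have hker : reducingIsometricPart T ≤ LinearMap.ker ((1 - T† * T : H →L[ℂ] H) : H →ₗ[ℂ] H) := by
    refine Submodule.topologicalClosure_minimal _ (sSup_le fun M hM y hy => ?_)
      (ContinuousLinearMap.isClosed_ker (1 - T† * T : H →L[ℂ] H))
    obtain ⟨⟨-, h1, h2⟩, h3⟩ := hM
    have hz : y - (T†) (T y) ∈ M := M.sub_mem hy (h2 _ (h1 _ hy))
    have hin : ∀ a ∈ M, ∀ b ∈ M, inner ℂ (T a) (T b) = inner ℂ a b := by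
      intro a ha b hb
      let U : M →ₗᵢ[ℂ] H := ⟨(T : H →ₗ[ℂ] H).comp M.subtype, fun x => h3 x x.2⟩
      exact U.inner_map_map ⟨a, ha⟩ ⟨b, hb⟩
    have h0 : inner ℂ (y - (T†) (T y)) (y - (T†) (T y)) = (0 : ℂ) := by
      nth_rewrite 1 [inner_sub_left]
      rw [ContinuousLinearMap.adjoint_inner_left, hin _ hy _ hz, sub_self]
    have := inner_self_eq_zero.mp h0
    simpa using this
  refine ⟨⟨⟨Submodule.isClosed_topologicalClosure _, hmap T fun M hM => hM.1.2.1,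
    hmap (T†) fun M hM => hM.1.2.2⟩, fun x hx => ?_⟩, fun M hM => ?_⟩
  · have h1 : x - (T†) (T x) = 0 := by simpa using hker hx
    have h2 : (inner ℂ (T x) (T x) : ℂ) = inner ℂ x x := by
      rw [← ContinuousLinearMap.adjoint_inner_left, ← sub_eq_zero.mp h1]
    rw [inner_self_eq_norm_sq_to_K, inner_self_eq_norm_sq_to_K] at h2
    have h3 : ‖T x‖ ^ 2 = ‖x‖ ^ 2 := by exact_mod_cast h2
    exact (pow_left_inj₀ (norm_nonneg _) (norm_nonneg _) two_ne_zero).mp h3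
  · exact (le_sSup (a := M) hM).trans (Submodule.le_topologicalClosure _)

theorem exists_isStrongLimit {T : H →L[ℂ] H} (hT : ‖T‖ ≤ 1) : ∃ S, IsStrongLimit T S := by
  have hpow : ∀ (R : H →L[ℂ] H), ‖R‖ ≤ 1 → ∀ (n : ℕ) (x : H), ‖(R ^ n) x‖ ≤ ‖x‖ := by
    intro R hR n x
    induction n with
    | zero => simp
    | succ n ih =>
      rw [pow_succ', mul_apply_eq_comp]
      exact (R.le_of_opNorm_le hR _).trans (by simpa using ih)
  have hT' : ‖T†‖ ≤ 1 := by rwa [LinearIsometryEquiv.norm_map]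
  have hadj : ∀ n : ℕ, (T ^ n)† = (T†) ^ n := fun n => by
    rw [← ContinuousLinearMap.star_eq_adjoint, ← ContinuousLinearMap.star_eq_adjoint, star_pow]
  have key : ∀ (x : H) (n k : ℕ),
      ‖((T†) ^ (n + k) * T ^ (n + k)) x - ((T†) ^ n * T ^ n) x‖ ^ 2 ≤
        ‖(T ^ n) x‖ ^ 2 - ‖(T ^ (n + k)) x‖ ^ 2 := by
    intro x n k
    set y := (T ^ n) x with hy
    set z := (T ^ k) y with hz
    have e1 : (T ^ (n + k)) x = z := by
      rw [add_comm, pow_add, mul_apply_eq_comp]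
    have e2 : ((T†) ^ (n + k) * T ^ (n + k)) x - ((T†) ^ n * T ^ n) x
        = ((T†) ^ n) (((T†) ^ k) z - y) := by
      rw [mul_apply_eq_comp, e1, pow_add, mul_apply_eq_comp,
        mul_apply_eq_comp, map_sub]
    have e3 : RCLike.re (inner ℂ (((T†) ^ k) z) y) = ‖z‖ ^ 2 := by
      rw [← hadj, ContinuousLinearMap.adjoint_inner_left, ← hz, inner_self_eq_norm_sq]
    have e4 : ‖((T†) ^ k) z - y‖ ^ 2 ≤ ‖y‖ ^ 2 - ‖z‖ ^ 2 := by
      rw [@norm_sub_sq ℂ, e3]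
      have := pow_le_pow_left₀ (norm_nonneg _) (hpow _ hT' k z) 2
      linarith
    rw [e1, e2]
    exact (pow_le_pow_left₀ (norm_nonneg _) (hpow _ hT' n _) 2).trans e4
  have hex : ∀ x : H, ∃ y, Tendsto (fun n : ℕ => ((T†) ^ n * T ^ n) x) atTop (𝓝 y) := by
    intro x
    have hanti : Antitone fun n : ℕ => ‖(T ^ n) x‖ ^ 2 := by
      refine antitone_nat_of_succ_le fun n => ?_
      have := (sq_nonneg _).trans (key x n 1)
      linarith
    have hconv : CauchySeq fun n : ℕ => ‖(T ^ n) x‖ ^ 2 :=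
      (tendsto_atTop_ciInf hanti ⟨0, by rintro _ ⟨n, rfl⟩; positivity⟩).cauchySeq
    refine cauchySeq_tendsto_of_complete (Metric.cauchySeq_iff'.mpr fun ε hε => ?_)
    obtain ⟨N, hN⟩ := Metric.cauchySeq_iff'.mp hconv (ε ^ 2) (by positivity)
    refine ⟨N, fun n hn => ?_⟩
    obtain ⟨k, rfl⟩ := Nat.exists_eq_add_of_le hn
    have h1 := hN (N + k) hn
    rw [Real.dist_eq, abs_sub_comm] at h1
    have h2 := (key x N k).trans_lt ((le_abs_self _).trans_lt h1)
    rw [dist_eq_norm]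
    exact lt_of_pow_lt_pow_left₀ 2 hε.le h2
  choose f hf using hex
  exact ⟨continuousLinearMapOfTendsto (fun n : ℕ => (T†) ^ n * T ^ n)
    (tendsto_pi_nhds.mpr hf), hf⟩

theorem isStrongLimit_asymptoticLimit {T : H →L[ℂ] H} (hT : ‖T‖ ≤ 1) :
    IsStrongLimit T (asymptoticLimit T) := by
  have h := exists_isStrongLimit hT
  rw [asymptoticLimit, dif_pos h]
  exact h.choose_spec

/-- The kernel `N(A)` of a bounded operator. -/
abbrev kernel (A : H →L[ℂ] H) : Submodule ℂ H := LinearMap.ker (A : H →ₗ[ℂ] H)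

end Operators

section Dilations

variable {H : Type u} [NormedAddCommGroup H] [InnerProductSpace ℂ H] [CompleteSpace H]
variable {K : Type v} [NormedAddCommGroup K] [InnerProductSpace ℂ K] [CompleteSpace K]
variable {K' : Type w} [NormedAddCommGroup K'] [InnerProductSpace ℂ K'] [CompleteSpace K']

/-- `V`, acting on the Hilbert space `K` that contains `H` through the isometric embedding `ι`, is
a minimal isometric dilation of `T`: `V` is an isometry, `K` is the closed linear span of the
subspaces `Vⁿ H`, and `P V = T P`, where `P = ι*` is the orthogonal projection of `K` onto `H`. -/
structure IsMinimalIsometricDilation (T : H →L[ℂ] H) (ι : H →ₗᵢ[ℂ] K) (V : K →L[ℂ] K) : Prop where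
  isometry : ∀ x, ‖V x‖ = ‖x‖
  minimal : (Submodule.span ℂ {x : K | ∃ (n : ℕ) (h : H), x = (V ^ n) (ι h)}).topologicalClosure = ⊤
  dilation : (ι.toContinuousLinearMap)† ∘L V = T ∘L (ι.toContinuousLinearMap)†

/-- `A : K' → K` is the Harnack operator of the pair whose minimal isometric dilations are
`(ι, V)` on `K` and `(ι', V')` on `K'`: a bounded operator that is the identity on `H`
and satisfies `A V' = V A`. By minimality of `V'` there is at most one. -/
def IsHarnackOperator (ι : H →ₗᵢ[ℂ] K) (V : K →L[ℂ] K) (ι' : H →ₗᵢ[ℂ] K') (V' : K' →L[ℂ] K')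
    (A : K' →L[ℂ] K) : Prop :=
  (∀ h : H, A (ι' h) = ι h) ∧ A ∘L V' = V ∘L A

end Dilations

end HarnackParts

end

namespace HarnackParts

/-! Harnack domination is first turned into an inequality for finite families of vectors: the
quadratic form of the Toeplitz kernel of `T` is at most `c` times that of `T'`
(`HarnackDominated.exists_correlation_le`). It comes from testing on rotated Fejér polynomials,
averaging over roots of unity and letting the degree tend to infinity.

Two choices of vectors carry the theorem. The pair `-T' x, x` annihilates the form of `T'` when `‖T'
x‖ = ‖x‖`, which forces `T x = T' x` (`HarnackDominated.apply_eq_of_norm_eq`). Commutation then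
transfers reducing subspaces from `T'` to `T` (`IsReducingIsometric.of_commute`), so the isometric
part of `T'` reduces `T` and lies in that of `T`; symmetry gives (iv).

For the equalities in (ii), take the `T`-orbit of `k = T g - T' g` inside `N(I - S_T)`: the form of
`T` grows like `N² ‖k‖²`, that of `T'` telescopes to `O(N)`, hence `k = 0`
(`HarnackDominated.eqOn_of_isometric`). -/

variable {H : Type u} [NormedAddCommGroup H] [InnerProductSpace ℂ H]

/-! ### Fejér polynomials and their positivity -/

/-- The analytic polynomial whose real part is `n` times the Fejér kernel of order `n`, rotated
by `w`. -/
noncomputable def fejerPoly (n : ℕ) (w : ℂ) : Polynomial ℂ :=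
  Polynomial.C (n : ℂ) + ∑ m ∈ Finset.range n,
    Polynomial.C (2 * ((n : ℂ) - 1 - m) * w ^ (m + 1)) * Polynomial.X ^ (m + 1)

theorem eval_fejerPoly (n : ℕ) (w z : ℂ) : (fejerPoly n w).eval z =
    n + ∑ m ∈ Finset.range n, 2 * ((n : ℂ) - 1 - m) * (w * z) ^ (m + 1) := by
  simp [fejerPoly, Polynomial.eval_finsetSum, mul_pow, mul_assoc]

/-- With `S n` the geometric sum, passing from `n` to `n + 1` adds `Re (1 + 2 z S n)`, which is read
off from `S (n + 1) = 1 + z S n`. The sum of squares gives positivity on the whole closed disc at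
once. -/
theorem re_fejer_sum (z : ℂ) (n : ℕ) :
    ((n : ℂ) + ∑ m ∈ Finset.range n, 2 * ((n : ℂ) - 1 - m) * z ^ (m + 1)).re =
      ‖∑ i ∈ Finset.range n, z ^ i‖ ^ 2 +
        (1 - ‖z‖ ^ 2) * ∑ l ∈ Finset.range n, ‖∑ i ∈ Finset.range l, z ^ i‖ ^ 2 := by
  induction n with
  | zero => simp
  | succ n ih =>
    have h1 : ((n + 1 : ℕ) : ℂ) + ∑ m ∈ Finset.range (n + 1),
        2 * (((n + 1 : ℕ) : ℂ) - 1 - m) * z ^ (m + 1) =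
        ((n : ℂ) + ∑ m ∈ Finset.range n, 2 * ((n : ℂ) - 1 - m) * z ^ (m + 1)) +
          (1 + 2 * (z * ∑ i ∈ Finset.range n, z ^ i)) := by
      rw [Finset.sum_range_succ, Finset.mul_sum, Finset.mul_sum]
      have : ∑ m ∈ Finset.range n, 2 * (((n + 1 : ℕ) : ℂ) - 1 - m) * z ^ (m + 1) =
          ∑ m ∈ Finset.range n, 2 * ((n : ℂ) - 1 - m) * z ^ (m + 1) +
            ∑ m ∈ Finset.range n, 2 * (z * z ^ m) := by
        rw [← Finset.sum_add_distrib]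
        refine Finset.sum_congr rfl fun m _ => ?_
        push_cast; ring
      rw [this]; push_cast; ring
    have h2 : ∑ i ∈ Finset.range (n + 1), z ^ i = 1 + z * ∑ i ∈ Finset.range n, z ^ i := by
      rw [geom_sum_succ]; ring
    have h3 : ‖1 + z * ∑ i ∈ Finset.range n, z ^ i‖ ^ 2 =
        1 + 2 * (z * ∑ i ∈ Finset.range n, z ^ i).re +
          ‖z‖ ^ 2 * ‖∑ i ∈ Finset.range n, z ^ i‖ ^ 2 := by
      rw [← mul_pow, ← norm_mul]
      generalize z * ∑ i ∈ Finset.range n, z ^ i = y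
      rw [← Complex.normSq_eq_norm_sq, ← Complex.normSq_eq_norm_sq, Complex.normSq_apply,
        Complex.normSq_apply]
      simp; ring
    rw [h1, h2, h3, Complex.add_re, ih, Finset.sum_range_succ _ n]
    simp; ring

theorem re_eval_fejerPoly_nonneg (n : ℕ) {w z : ℂ} (hw : ‖w‖ ≤ 1) (hz : ‖z‖ ≤ 1) :
    0 ≤ ((fejerPoly n w).eval z).re := by
  rw [eval_fejerPoly, re_fejer_sum]
  have h : ‖w * z‖ ≤ 1 := by
    rw [norm_mul]; exact mul_le_one₀ hw (norm_nonneg _) hz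
  have h' : 0 ≤ 1 - ‖w * z‖ ^ 2 := by
    have := pow_le_one₀ (n := 2) (norm_nonneg _) h
    linarith
  positivity

/-! ### Averaging over roots of unity -/

/-- The sum over the `L`-th roots of unity `ζˢ` of a trigonometric monomial. -/
theorem sum_zpow_primitiveRoot {L : ℕ} {ζ : ℂ} (hζ : IsPrimitiveRoot ζ L) (a : ℤ)
    (ha : |a| < L) : ∑ s ∈ Finset.range L, (ζ ^ s) ^ a = if a = 0 then (L : ℂ) else 0 := by
  have h1 : ∀ s : ℕ, (ζ ^ s) ^ a = (ζ ^ a) ^ s := fun s => by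
    rw [← zpow_natCast, ← zpow_natCast, ← zpow_mul, ← zpow_mul, mul_comm]
  simp_rw [h1]
  split_ifs with h
  · simp [h]
  · have hne : ζ ^ a ≠ 1 := fun h0 =>
      h (Int.eq_zero_of_abs_lt_dvd ((hζ.zpow_eq_one_iff_dvd a).mp h0) ha)
    rw [geom_sum_eq hne, ← zpow_natCast, ← zpow_mul, mul_comm a, zpow_mul, zpow_natCast,
      hζ.pow_eq_one]
    simp

theorem inner_aeval_fejerPoly (T : H →L[ℂ] H) (n : ℕ) (w : ℂ) (y : H) :
    inner ℂ y (Polynomial.aeval T (fejerPoly n w) y) = n * inner ℂ y y +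
      ∑ m ∈ Finset.range n, 2 * ((n : ℂ) - 1 - m) * w ^ (m + 1) * inner ℂ y ((T ^ (m + 1)) y) := by
  have h : Polynomial.aeval T (fejerPoly n w) y = (n : ℂ) • y +
      ∑ m ∈ Finset.range n, (2 * ((n : ℂ) - 1 - m) * w ^ (m + 1)) • (T ^ (m + 1)) y := by
    have hm : ∀ (a : ℂ) (k : ℕ), Polynomial.aeval T (Polynomial.C a * Polynomial.X ^ k) =
        a • T ^ k := fun a k => by
      rw [map_mul, Polynomial.aeval_C, map_pow, Polynomial.aeval_X, ← Algebra.smul_def]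
    rw [fejerPoly, map_add, map_sum, Polynomial.aeval_C, Algebra.algebraMap_eq_smul_one]
    simp only [hm, add_apply, sum_apply, smul_apply, one_apply_eq_self]
  rw [h, inner_add_right, inner_smul_right, inner_sum]
  simp only [inner_smul_right]

/-- The average over the roots of unity of the sesquilinear forms of a fixed operator `R`. -/
theorem sum_inner_primitiveRoot {L N : ℕ} {ζ : ℂ} (hζ : IsPrimitiveRoot ζ L) (hL : 0 < L)
    (R : H →L[ℂ] H) (x : ℕ → H) (m : ℕ) (hm : m + N ≤ L) :
    ∑ s ∈ Finset.range L, ((ζ ^ s)⁻¹) ^ m * inner ℂ (∑ k ∈ Finset.range N, (ζ ^ s) ^ k • x k)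
        (R (∑ j ∈ Finset.range N, (ζ ^ s) ^ j • x j)) =
      L * ∑ k ∈ Finset.range N, ∑ j ∈ Finset.range N,
        if j = k + m then inner ℂ (x k) (R (x j)) else 0 := by
  have hn : ‖ζ‖ = 1 := hζ.norm'_eq_one hL.ne'
  have h0 : ζ ≠ 0 := hζ.ne_zero hL.ne'
  have hc : ∀ s : ℕ, (starRingEnd ℂ) (ζ ^ s) = (ζ ^ s)⁻¹ := fun s => by
    rw [Complex.inv_eq_conj]; simp [hn]
  have h1 : ∀ s : ℕ, ((ζ ^ s)⁻¹) ^ m * inner ℂ (∑ k ∈ Finset.range N, (ζ ^ s) ^ k • x k)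
        (R (∑ j ∈ Finset.range N, (ζ ^ s) ^ j • x j)) =
      ∑ k ∈ Finset.range N, ∑ j ∈ Finset.range N,
        (ζ ^ s) ^ ((j : ℤ) - k - m) * inner ℂ (x k) (R (x j)) := by
    intro s
    have hs : ζ ^ s ≠ 0 := pow_ne_zero _ h0
    rw [map_sum, sum_inner, Finset.mul_sum]
    refine Finset.sum_congr rfl fun k _ => ?_
    rw [inner_sum, Finset.mul_sum]
    refine Finset.sum_congr rfl fun j _ => ?_
    rw [map_smul, inner_smul_left, inner_smul_right, map_pow, hc, zpow_sub₀ hs, zpow_sub₀ hs]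
    simp only [zpow_natCast, inv_pow]
    field_simp
  simp_rw [h1]
  rw [Finset.sum_comm, Finset.mul_sum]
  refine Finset.sum_congr rfl fun k hk => ?_
  rw [Finset.sum_comm, Finset.mul_sum]
  refine Finset.sum_congr rfl fun j hj => ?_
  -- Since `m + N ≤ L`, the exponent `j - k - m` has absolute value below `L`: no aliasing, and only
  -- `j = k + m` survives.
  rw [← Finset.sum_mul, sum_zpow_primitiveRoot hζ]
  · split_ifs <;> first | rfl | omega | simp
  · simp only [Finset.mem_range] at hk hj
    rw [abs_lt]; omega

/-- The `m`-th correlation of the vectors `x 0, …, x (N - 1)` relative to `T`. -/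
noncomputable def correlation (T : H →L[ℂ] H) (x : ℕ → H) (N m : ℕ) : ℝ :=
  ∑ k ∈ Finset.range (N - m), (inner ℂ (x k) ((T ^ m) (x (k + m)))).re

theorem re_sum_ite_inner_eq_correlation (T : H →L[ℂ] H) (x : ℕ → H) (N m : ℕ) :
    (∑ k ∈ Finset.range N, ∑ j ∈ Finset.range N,
      if j = k + m then (inner ℂ (x k) ((T ^ m) (x j)) : ℂ) else 0).re = correlation T x N m := by
  simp only [Finset.sum_ite_eq', Finset.mem_range, Complex.re_sum, correlation]
  rw [← Finset.sum_subset (Finset.range_mono (Nat.sub_le N m))]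
  · refine Finset.sum_congr rfl fun k hk => ?_
    rw [if_pos]
    have := Finset.mem_range.mp hk
    omega
  · intro k _ hk
    rw [if_neg, Complex.zero_re]
    have := mt Finset.mem_range.mpr hk
    omega

/-- Rotating the polynomial by `ζ⁻ˢ` while twisting `x k` by `ζˢᵏ` makes the average isolate, for
each power of `T`, the pairs of vectors whose indices differ by that power. -/
theorem re_sum_inner_aeval_fejerPoly {L N n : ℕ} {ζ : ℂ} (hζ : IsPrimitiveRoot ζ L) (hL : 0 < L)
    (hn : n + N ≤ L) (T : H →L[ℂ] H) (x : ℕ → H) :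
    ∑ s ∈ Finset.range L, (inner ℂ (∑ k ∈ Finset.range N, (ζ ^ s) ^ k • x k)
        (Polynomial.aeval T (fejerPoly n (ζ ^ s)⁻¹)
          (∑ j ∈ Finset.range N, (ζ ^ s) ^ j • x j))).re =
      L * (n * correlation T x N 0 +
        ∑ m ∈ Finset.range n, 2 * ((n : ℝ) - 1 - m) * correlation T x N (m + 1)) := by
  simp only [← re_sum_ite_inner_eq_correlation]
  rw [← Complex.re_sum]
  simp_rw [inner_aeval_fejerPoly]
  rw [Finset.sum_add_distrib, ← Finset.mul_sum, Finset.sum_comm]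
  have h0 := sum_inner_primitiveRoot hζ hL (1 : H →L[ℂ] H) x 0 (N := N) (by omega)
  simp only [pow_zero, one_mul, one_apply_eq_self] at h0
  have hm : ∀ m ∈ Finset.range n, ∑ s ∈ Finset.range L,
      2 * ((n : ℂ) - 1 - m) * (ζ ^ s)⁻¹ ^ (m + 1) * inner ℂ (∑ k ∈ Finset.range N, (ζ ^ s) ^ k • x k)
        ((T ^ (m + 1)) (∑ j ∈ Finset.range N, (ζ ^ s) ^ j • x j)) =
      ((2 * ((n : ℝ) - 1 - m) : ℝ) : ℂ) * (L * ∑ k ∈ Finset.range N, ∑ j ∈ Finset.range N,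
        if j = k + (m + 1) then inner ℂ (x k) ((T ^ (m + 1)) (x j)) else 0) := by
    intro m hm
    rw [← sum_inner_primitiveRoot hζ hL _ _ _ (by have := Finset.mem_range.mp hm; omega),
      Finset.mul_sum]
    refine Finset.sum_congr rfl fun s _ => ?_
    push_cast
    ring
  rw [Finset.sum_congr rfl hm, h0]
  simp only [pow_zero, one_apply_eq_self]
  rw [Complex.add_re, Complex.re_sum, mul_add]
  simp only [Complex.re_ofReal_mul, ← Complex.ofReal_natCast]
  congr 1
  · ring
  · rw [Finset.mul_sum]
    exact Finset.sum_congr rfl fun m _ => by ring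

theorem correlation_eq_zero (T : H →L[ℂ] H) (x : ℕ → H) {N m : ℕ} (h : N ≤ m) :
    correlation T x N m = 0 := by
  simp [correlation, Nat.sub_eq_zero_of_le h]

/-- Only finitely many `f m` are nonzero, and each normalized weight `2 (n - 1 - m) / n` tends to
`2`. -/
theorem tendsto_fejer_mean (f : ℕ → ℝ) {N : ℕ} (hf : ∀ m, N ≤ m → f m = 0) :
    Tendsto (fun n : ℕ => (n : ℝ)⁻¹ * (n * f 0 +
      ∑ m ∈ Finset.range n, 2 * ((n : ℝ) - 1 - m) * f (m + 1))) atTop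
      (𝓝 (f 0 + 2 * ∑ m ∈ Finset.range N, f (m + 1))) := by
  have h1 : Tendsto (fun n : ℕ => f 0 + ∑ m ∈ Finset.range N,
      2 * (1 - (1 + m) * (n : ℝ)⁻¹) * f (m + 1)) atTop
      (𝓝 (f 0 + ∑ m ∈ Finset.range N, 2 * (1 - (1 + m) * 0) * f (m + 1))) := by
    refine tendsto_const_nhds.add (tendsto_finsetSum _ fun m _ => ?_)
    exact ((tendsto_const_nhds.sub
      (tendsto_const_nhds.mul tendsto_inv_atTop_nhds_zero_nat)).const_mul 2).mul_const _
  have h2 : f 0 + ∑ m ∈ Finset.range N, 2 * (1 - (1 + (m : ℝ)) * 0) * f (m + 1) =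
      f 0 + 2 * ∑ m ∈ Finset.range N, f (m + 1) := by
    simp [Finset.mul_sum]
  rw [h2] at h1
  refine h1.congr' ?_
  filter_upwards [eventually_ge_atTop (N + 1)] with n hn
  have hn0 : (n : ℝ) ≠ 0 := by
    have : n ≠ 0 := by omega
    exact_mod_cast this
  have h3 : ∑ m ∈ Finset.range n, 2 * ((n : ℝ) - 1 - m) * f (m + 1) =
      ∑ m ∈ Finset.range N, 2 * ((n : ℝ) - 1 - m) * f (m + 1) := by
    refine (Finset.sum_subset (Finset.range_mono (by omega)) fun m _ hm => ?_).symm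
    rw [hf _ (by have := mt Finset.mem_range.mpr hm; omega), mul_zero]
  rw [h3, mul_add, Finset.mul_sum, inv_mul_cancel_left₀ hn0]
  congr 1
  refine Finset.sum_congr rfl fun m _ => ?_
  field_simp
  ring

/-! ### Domination of Toeplitz kernels -/

section Complete

variable [CompleteSpace H]

theorem re_inner_le_of_realPart_le {A B : H →L[ℂ] H} {c : ℝ}
    (h : (ℜ A : H →L[ℂ] H) ≤ c • (ℜ B : H →L[ℂ] H)) (y : H) :
    (inner ℂ y (A y)).re ≤ c * (inner ℂ y (B y)).re := by
  have key : ∀ R : H →L[ℂ] H,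
      (inner ℂ y ((ℜ R : H →L[ℂ] H) y)).re = (inner ℂ y (R y)).re := by
    intro R
    rw [realPart_apply_coe, ContinuousLinearMap.star_eq_adjoint, smul_apply, add_apply,
      ← Complex.coe_smul, inner_smul_right, inner_add_right, ContinuousLinearMap.adjoint_inner_right,
      ← inner_conj_symm (R y) y, Complex.re_ofReal_mul, Complex.add_re, Complex.conj_re]
    ring
  have h1 := ((ContinuousLinearMap.isPositive_iff _).mp
    (ContinuousLinearMap.le_def _ _ |>.mp h)).2 y
  have h2 := (Complex.le_def.mp h1).1
  rw [sub_apply, smul_apply, ← Complex.coe_smul, inner_sub_left, inner_smul_left,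
    ← inner_conj_symm _ y, ← inner_conj_symm ((ℜ A : H →L[ℂ] H) y) y, Complex.conj_ofReal,
    Complex.sub_re, Complex.re_ofReal_mul, Complex.conj_re, Complex.conj_re, key, key,
    Complex.zero_re] at h2
  linarith

/-- The operator-valued form of Harnack domination: the Toeplitz kernel of `T` is dominated by a
multiple of the Toeplitz kernel of `T'`. -/
theorem HarnackDominated.exists_correlation_le {T T' : H →L[ℂ] H} (h : HarnackDominated T T') :
    ∃ c : ℝ, 0 ≤ c ∧ ∀ (x : ℕ → H) (N : ℕ),
      correlation T x N 0 + 2 * ∑ m ∈ Finset.range N, correlation T x N (m + 1) ≤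
        c * (correlation T' x N 0 + 2 * ∑ m ∈ Finset.range N, correlation T' x N (m + 1)) := by
  obtain ⟨c, hc1, hc⟩ := h
  refine ⟨c, by linarith, fun x N => le_of_tendsto_of_tendsto
    (tendsto_fejer_mean _ fun m hm => correlation_eq_zero T x hm)
    ((tendsto_fejer_mean _ fun m hm => correlation_eq_zero T' x hm).const_mul c) ?_⟩
  filter_upwards [eventually_ge_atTop 1] with n hn
  have hL : 0 < n + N := by omega
  have hζ := Complex.isPrimitiveRoot_exp (n + N) hL.ne'
  set ζ := Complex.exp (2 * Real.pi * Complex.I / (n + N : ℕ))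
  have h1 := Finset.sum_le_sum fun s (_ : s ∈ Finset.range (n + N)) =>
    re_inner_le_of_realPart_le (hc (fejerPoly n (ζ ^ s)⁻¹) fun z hz =>
      re_eval_fejerPoly_nonneg n (by simp [hζ.norm'_eq_one hL.ne']) hz)
      (∑ k ∈ Finset.range N, (ζ ^ s) ^ k • x k)
  rw [← Finset.mul_sum, re_sum_inner_aeval_fejerPoly hζ hL le_rfl,
    re_sum_inner_aeval_fejerPoly hζ hL le_rfl, mul_left_comm] at h1
  have h2 := le_of_mul_le_mul_left h1 (by exact_mod_cast hL)
  rw [mul_left_comm]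
  exact mul_le_mul_of_nonneg_left h2 (by positivity)

end Complete

/-! ### Weighted sums and isometric orbits -/

theorem sum_range_succ_weighted (f : ℕ → ℝ) (N : ℕ) :
    ∑ m ∈ Finset.range (N + 1), (((N + 1 : ℕ) : ℝ) - (m + 1)) * f m =
      ∑ m ∈ Finset.range N, ((N : ℝ) - (m + 1)) * f m + ∑ m ∈ Finset.range N, f m := by
  rw [Finset.sum_range_succ, ← Finset.sum_add_distrib]
  push_cast
  rw [sub_self, zero_mul, add_zero]
  exact Finset.sum_congr rfl fun m _ => by ring

theorem sum_range_weighted_const (a : ℝ) (N : ℕ) :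
    N * a + 2 * ∑ m ∈ Finset.range N, ((N : ℝ) - (m + 1)) * a = N ^ 2 * a := by
  induction N with
  | zero => simp
  | succ N ih =>
    rw [sum_range_succ_weighted fun _ => a]
    simp only [Finset.sum_const, Finset.card_range, nsmul_eq_mul] at ih ⊢
    push_cast
    linarith

/-- The weights make this a sum of `N` ordinary telescoping sums, each at most `2 * B`. -/
theorem sum_range_weighted_telescope_le (b : ℕ → ℝ) {B : ℝ} (hb : ∀ m, |b m| ≤ B) (N : ℕ) :
    ∑ m ∈ Finset.range N, ((N : ℝ) - (m + 1)) * (b m - b (m + 1)) ≤ N * (2 * B) := by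
  induction N with
  | zero => simp
  | succ N ih =>
    rw [sum_range_succ_weighted fun m => b m - b (m + 1), Finset.sum_range_sub']
    have h0 := abs_le.mp (hb 0)
    have hN := abs_le.mp (hb N)
    push_cast
    linarith

theorem norm_pow_apply_le {T : H →L[ℂ] H} (hT : ‖T‖ ≤ 1) (n : ℕ) (x : H) :
    ‖(T ^ n) x‖ ≤ ‖x‖ := by
  induction n with
  | zero => simp
  | succ n ih =>
    rw [pow_succ', mul_apply_eq_comp]
    exact (T.le_of_opNorm_le hT _).trans (by simpa using ih)

theorem norm_pow_le_one {T : H →L[ℂ] H} (hT : ‖T‖ ≤ 1) (n : ℕ) : ‖T ^ n‖ ≤ 1 :=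
  ContinuousLinearMap.opNorm_le_bound _ zero_le_one fun x => by
    simpa using norm_pow_apply_le hT n x

theorem inner_map_map_of_norm_map {T : H →L[ℂ] H} {M : Submodule ℂ H}
    (hM : ∀ x ∈ M, ‖T x‖ = ‖x‖) {a b : H} (ha : a ∈ M) (hb : b ∈ M) :
    inner ℂ (T a) (T b) = inner ℂ a b := by
  let U : M →ₗᵢ[ℂ] H := ⟨(T : H →ₗ[ℂ] H).comp M.subtype, fun x => hM x x.2⟩
  exact U.inner_map_map ⟨a, ha⟩ ⟨b, hb⟩

theorem inner_pow_pow_of_norm_map {T : H →L[ℂ] H} {M : Submodule ℂ H}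
    (hinv : ∀ x ∈ M, T x ∈ M) (hM : ∀ x ∈ M, ‖T x‖ = ‖x‖) (n : ℕ) {a b : H} (ha : a ∈ M)
    (hb : b ∈ M) : inner ℂ ((T ^ n) a) ((T ^ n) b) = inner ℂ a b := by
  induction n generalizing a b with
  | zero => simp
  | succ n ih =>
    rw [pow_succ, mul_apply_eq_comp, mul_apply_eq_comp, ih (hinv _ ha) (hinv _ hb),
      inner_map_map_of_norm_map hM ha hb]

theorem pow_apply_mem {T : H →L[ℂ] H} {M : Submodule ℂ H} (hinv : ∀ x ∈ M, T x ∈ M) (n : ℕ)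
    {a : H} (ha : a ∈ M) : (T ^ n) a ∈ M := by
  induction n with
  | zero => simpa
  | succ n ih =>
    rw [pow_succ', mul_apply_eq_comp]
    exact hinv _ ih

/-- Exponents decrease along the orbit so that `T ^ (N - (k + m))` can be pulled out of both sides
of the inner product and cancelled by isometry; the `N - m` terms become equal. -/
theorem correlation_orbit (T R : H →L[ℂ] H) (hTR : Commute T R) {M : Submodule ℂ H}
    (hTM : ∀ x ∈ M, T x ∈ M) (hRM : ∀ x ∈ M, R x ∈ M) (hM : ∀ x ∈ M, ‖T x‖ = ‖x‖) {h : H}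
    (hh : h ∈ M) (N m : ℕ) :
    correlation R (fun k => (T ^ (N - k)) h) N m =
      ((N - m : ℕ) : ℝ) * (inner ℂ ((T ^ m) h) ((R ^ m) h)).re := by
  have key : ∀ k ∈ Finset.range (N - m),
      (inner ℂ ((T ^ (N - k)) h) ((R ^ m) ((T ^ (N - (k + m))) h))).re =
        (inner ℂ ((T ^ m) h) ((R ^ m) h)).re := by
    intro k hk
    have hk' : N - k = N - (k + m) + m := by
      have := Finset.mem_range.mp hk
      omega
    have h1 : (R ^ m) ((T ^ (N - (k + m))) h) = (T ^ (N - (k + m))) ((R ^ m) h) := by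
      rw [← mul_apply_eq_comp, ← mul_apply_eq_comp, (hTR.pow_pow _ m).eq]
    rw [h1, hk', pow_add, mul_apply_eq_comp,
      inner_pow_pow_of_norm_map hTM hM _ (pow_apply_mem hTM _ hh) (pow_apply_mem hRM _ hh)]
  rw [correlation, Finset.sum_congr rfl key]
  simp

theorem sum_correlation_orbit (T R : H →L[ℂ] H) (hTR : Commute T R) {M : Submodule ℂ H}
    (hTM : ∀ x ∈ M, T x ∈ M) (hRM : ∀ x ∈ M, R x ∈ M) (hM : ∀ x ∈ M, ‖T x‖ = ‖x‖) {h : H}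
    (hh : h ∈ M) (N : ℕ) :
    correlation R (fun k => (T ^ (N - k)) h) N 0 + 2 * ∑ m ∈ Finset.range N,
        correlation R (fun k => (T ^ (N - k)) h) N (m + 1) =
      N * ‖h‖ ^ 2 + 2 * ∑ m ∈ Finset.range N, ((N : ℝ) - (m + 1)) *
        (inner ℂ ((T ^ (m + 1)) h) ((R ^ (m + 1)) h)).re := by
  simp only [correlation_orbit T R hTR hTM hRM hM hh]
  congr 1
  · have : (inner ℂ h h : ℂ).re = ‖h‖ ^ 2 := inner_self_eq_norm_sq (𝕜 := ℂ) h
    simp [this, -inner_self_eq_norm_sq_to_K]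
  · congr 1
    refine Finset.sum_congr rfl fun m hm => ?_
    rw [Nat.cast_sub (by have := Finset.mem_range.mp hm; omega)]
    push_cast
    rfl

/-! ### Vectors on which the two contractions agree -/

section Complete

variable [CompleteSpace H]

/-- If a contraction `T` is Harnack dominated by `T'`, then `T` agrees with `T'` on vectors whose
norm is preserved by `T'`. -/
theorem HarnackDominated.apply_eq_of_norm_eq {T T' : H →L[ℂ] H} (h : HarnackDominated T T')
    (hT : ‖T‖ ≤ 1) {x : H} (hx : ‖T' x‖ = ‖x‖) : T x = T' x := by
  obtain ⟨c, -, hc⟩ := h.exists_correlation_le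
  -- For `R = T'` this value is `‖x‖² - ‖T' x‖² = 0`; for `R = T` it is at least `‖T' x - T x‖²`,
  -- because `‖T x‖ ≤ ‖x‖`.
  have key : ∀ R : H →L[ℂ] H, correlation R (fun k => if k = 0 then -T' x else x) 2 0 +
      2 * ∑ m ∈ Finset.range 2, correlation R (fun k => if k = 0 then -T' x else x) 2 (m + 1) =
        ‖T' x‖ ^ 2 + ‖x‖ ^ 2 - 2 * (inner ℂ (T' x) (R x)).re := by
    intro R
    have h1 : ∀ y : H, (inner ℂ y y : ℂ).re = ‖y‖ ^ 2 := inner_self_eq_norm_sq (𝕜 := ℂ)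
    simp [correlation, Finset.sum_range_succ, -inner_self_eq_norm_sq_to_K, h1]
    ring
  have h1 := hc (fun k => if k = 0 then -T' x else x) 2
  have h3 : (inner ℂ (T' x) (T' x) : ℂ).re = ‖T' x‖ ^ 2 := inner_self_eq_norm_sq (𝕜 := ℂ) _
  rw [key, key, h3, hx] at h1
  have h4 : ‖T x‖ ^ 2 ≤ ‖x‖ ^ 2 :=
    pow_le_pow_left₀ (norm_nonneg _) (by simpa using T.le_of_opNorm_le hT x) 2
  have h5 : ‖T' x - T x‖ ^ 2 = ‖T' x‖ ^ 2 - 2 * (inner ℂ (T' x) (T x)).re + ‖T x‖ ^ 2 :=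
    norm_sub_sq (𝕜 := ℂ) _ _
  rw [hx] at h5
  have h6 : ‖T' x - T x‖ ^ 2 ≤ 0 := by
    have : c * (‖x‖ ^ 2 + ‖x‖ ^ 2 - 2 * ‖x‖ ^ 2) = 0 := by ring
    linarith
  have h7 : ‖T' x - T x‖ = 0 := pow_eq_zero_iff two_ne_zero |>.mp (le_antisymm h6 (by positivity))
  exact (sub_eq_zero.mp (norm_eq_zero.mp h7)).symm

/-- Commuting contractions `T`, `T'`, the first Harnack dominated by the second, agree on every common
invariant subspace on which `T` is isometric. -/
theorem HarnackDominated.eqOn_of_isometric {T T' : H →L[ℂ] H} (h : HarnackDominated T T')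
    (hT : ‖T‖ ≤ 1) (hT' : ‖T'‖ ≤ 1) (hcomm : Commute T T') {M : Submodule ℂ H}
    (hTM : ∀ x ∈ M, T x ∈ M) (hTM' : ∀ x ∈ M, T' x ∈ M) (hM : ∀ x ∈ M, ‖T x‖ = ‖x‖) {g : H}
    (hg : g ∈ M) : T' g = T g := by
  obtain ⟨c, hc0, hc⟩ := h.exists_correlation_le
  set k := T g - T' g with hk
  have hkM : k ∈ M := M.sub_mem (hTM _ hg) (hTM' _ hg)
  set b : ℕ → ℝ := fun m => (inner ℂ ((T ^ (m + 1)) k) ((T' ^ (m + 1)) (T g))).re with hb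
  have hbB : ∀ m, |b m| ≤ ‖k‖ * ‖g‖ := fun m => by
    refine (Complex.abs_re_le_norm _).trans ((norm_inner_le_norm _ _).trans ?_)
    refine mul_le_mul (norm_pow_apply_le hT _ _) ?_ (norm_nonneg _) (norm_nonneg _)
    exact (norm_pow_apply_le hT' _ _).trans (hM g hg).le
  have hab : ∀ m : ℕ, (inner ℂ ((T ^ (m + 1)) k) ((T' ^ (m + 1)) k)).re = b m - b (m + 1) := by
    intro m
    -- Inserting one more `T` on both sides costs nothing on `M`; after commuting it past `T'`, the
    -- `T' g` half of the correlation is the next `b`.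
    have h1 : (inner ℂ ((T ^ (m + 1)) k) ((T' ^ (m + 1)) (T' g)) : ℂ) =
        inner ℂ ((T ^ (m + 1 + 1)) k) ((T' ^ (m + 1 + 1)) (T g)) := by
      rw [← mul_apply_eq_comp (T' ^ (m + 1 + 1)) T, ← (hcomm.pow_right (m + 1 + 1)).eq,
        mul_apply_eq_comp, pow_succ' T (m + 1), mul_apply_eq_comp,
        inner_map_map_of_norm_map hM (pow_apply_mem hTM _ hkM) (pow_apply_mem hTM' _ hg),
        pow_succ T' (m + 1), mul_apply_eq_comp]
    simp only [hb]
    rw [← h1, ← Complex.sub_re, ← inner_sub_right, ← map_sub, ← hk]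
  -- Quadratic growth for `T` against linear growth for `T'`, divided by `N`.
  have hbound : ∀ N : ℕ, (N : ℝ) * ‖k‖ ^ 2 ≤ c * (‖k‖ ^ 2 + 4 * (‖k‖ * ‖g‖)) := by
    intro N
    rcases Nat.eq_zero_or_pos N with rfl | hN
    · simp only [Nat.cast_zero, zero_mul]
      positivity
    have h1 := hc (fun j => (T ^ (N - j)) k) N
    rw [sum_correlation_orbit T T (Commute.refl T) hTM hTM hM hkM,
      sum_correlation_orbit T T' hcomm hTM hTM' hM hkM] at h1
    have h2 : ∀ m : ℕ, (inner ℂ ((T ^ (m + 1)) k) ((T ^ (m + 1)) k) : ℂ).re = ‖k‖ ^ 2 := fun m => by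
      rw [inner_pow_pow_of_norm_map hTM hM _ hkM hkM]
      exact inner_self_eq_norm_sq (𝕜 := ℂ) k
    simp only [h2, hab] at h1
    rw [sum_range_weighted_const] at h1
    refine le_of_mul_le_mul_left ?_ (show (0 : ℝ) < N by exact_mod_cast hN)
    calc (N : ℝ) * (N * ‖k‖ ^ 2) = N ^ 2 * ‖k‖ ^ 2 := by ring
      _ ≤ c * (N * ‖k‖ ^ 2 + 2 * (N * (2 * (‖k‖ * ‖g‖)))) := by
        refine h1.trans ?_
        gcongr
        exact sum_range_weighted_telescope_le b hbB N
      _ = N * (c * (‖k‖ ^ 2 + 4 * (‖k‖ * ‖g‖))) := by ring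
  have hk0 : ‖k‖ ^ 2 = 0 := by
    by_contra h0
    have hpos : 0 < ‖k‖ ^ 2 := lt_of_le_of_ne (by positivity) (Ne.symm h0)
    obtain ⟨N, hN⟩ := exists_nat_gt (c * (‖k‖ ^ 2 + 4 * (‖k‖ * ‖g‖)) / ‖k‖ ^ 2)
    rw [div_lt_iff₀ hpos] at hN
    exact absurd (hbound N) (not_le.mpr hN)
  exact (sub_eq_zero.mp (norm_eq_zero.mp (pow_eq_zero_iff two_ne_zero |>.mp hk0))).symm

/-! ### The kernel of `I - S_T` -/

theorem adjoint_apply_apply_of_norm_eq {T : H →L[ℂ] H} (hT : ‖T‖ ≤ 1) {x : H}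
    (hx : ‖T x‖ = ‖x‖) : (T†) (T x) = x := by
  have hT' : ‖T†‖ ≤ 1 := by rwa [LinearIsometryEquiv.norm_map]
  have h1 : ‖(T†) (T x)‖ ^ 2 ≤ ‖x‖ ^ 2 :=
    pow_le_pow_left₀ (norm_nonneg _) (by simpa [hx] using (T†).le_of_opNorm_le hT' (T x)) 2
  have h2 : ‖(T†) (T x) - x‖ ^ 2 =
      ‖(T†) (T x)‖ ^ 2 - 2 * RCLike.re (inner ℂ ((T†) (T x)) x) + ‖x‖ ^ 2 := norm_sub_sq _ _
  rw [ContinuousLinearMap.adjoint_inner_left, inner_self_eq_norm_sq, hx] at h2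
  have h3 : ‖(T†) (T x) - x‖ ^ 2 = 0 := le_antisymm (by linarith) (by positivity)
  exact sub_eq_zero.mp (norm_eq_zero.mp (pow_eq_zero_iff two_ne_zero |>.mp h3))

/-- The norms `‖Tⁿ x‖` decrease, with squares tending to `⟨S_T x, x⟩`, so `S_T x = x` leaves no room
for a drop. Conversely, preserved norms give `T*ⁿ Tⁿ x = x` for every `n`. -/
theorem mem_kernel_one_sub_asymptoticLimit_iff {T : H →L[ℂ] H} (hT : ‖T‖ ≤ 1) {x : H} :
    x ∈ kernel (1 - asymptoticLimit T) ↔ ∀ n : ℕ, ‖(T ^ n) x‖ = ‖x‖ := by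
  have hS := isStrongLimit_asymptoticLimit hT x
  have hadj : ∀ n : ℕ, (T†) ^ n = (T ^ n)† := fun n => by
    rw [← ContinuousLinearMap.star_eq_adjoint, ← ContinuousLinearMap.star_eq_adjoint, star_pow]
  have hmem : x ∈ kernel (1 - asymptoticLimit T) ↔ asymptoticLimit T x = x := by
    rw [LinearMap.mem_ker, ContinuousLinearMap.coe_coe, sub_apply, one_apply_eq_self, sub_eq_zero,
      eq_comm]
  simp only [mul_apply_eq_comp, hadj] at hS
  rw [hmem]
  constructor
  · intro h n
    rw [h] at hS
    have h1 : Tendsto (fun m : ℕ => ‖(T ^ m) x‖ ^ 2) atTop (𝓝 (‖x‖ ^ 2)) := by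
      have h2 := (Complex.continuous_re.tendsto _).comp (hS.inner (𝕜 := ℂ) (tendsto_const_nhds (x := x)))
      have h3 : (inner ℂ x x : ℂ).re = ‖x‖ ^ 2 := inner_self_eq_norm_sq (𝕜 := ℂ) x
      rw [h3] at h2
      refine h2.congr fun m => ?_
      simp only [Function.comp_apply]
      rw [ContinuousLinearMap.adjoint_inner_left]
      exact inner_self_eq_norm_sq (𝕜 := ℂ) _
    refine le_antisymm (norm_pow_apply_le hT n x) ?_
    refine le_of_sq_le_sq ?_ (norm_nonneg _)
    refine le_of_tendsto h1 ?_
    filter_upwards [eventually_ge_atTop n] with m hm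
    obtain ⟨k, rfl⟩ := Nat.exists_eq_add_of_le' hm
    rw [pow_add, mul_apply_eq_comp]
    exact pow_le_pow_left₀ (norm_nonneg _) (norm_pow_apply_le hT k _) 2
  · intro h
    refine tendsto_nhds_unique hS (tendsto_const_nhds.congr fun n => ?_)
    exact (adjoint_apply_apply_of_norm_eq (norm_pow_le_one hT n) (h n)).symm

theorem map_mem_kernel_one_sub_asymptoticLimit {T : H →L[ℂ] H} (hT : ‖T‖ ≤ 1) {x : H}
    (hx : x ∈ kernel (1 - asymptoticLimit T)) : T x ∈ kernel (1 - asymptoticLimit T) := by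
  rw [mem_kernel_one_sub_asymptoticLimit_iff hT] at hx ⊢
  intro n
  rw [← mul_apply_eq_comp, ← pow_succ, hx]
  simpa using (hx 1).symm

theorem norm_map_of_mem_kernel_one_sub_asymptoticLimit {T : H →L[ℂ] H} (hT : ‖T‖ ≤ 1) {x : H}
    (hx : x ∈ kernel (1 - asymptoticLimit T)) : ‖T x‖ = ‖x‖ := by
  simpa using (mem_kernel_one_sub_asymptoticLimit_iff hT).mp hx 1

/-- An invariant subspace on which `T` is isometric is contained in the kernel of `I - S_T`. -/
theorem le_kernel_one_sub_asymptoticLimit {T : H →L[ℂ] H} (hT : ‖T‖ ≤ 1) {M : Submodule ℂ H}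
    (hinv : ∀ x ∈ M, T x ∈ M) (hM : ∀ x ∈ M, ‖T x‖ = ‖x‖) :
    M ≤ kernel (1 - asymptoticLimit T) := by
  intro x hx
  refine (mem_kernel_one_sub_asymptoticLimit_iff hT).mpr fun n => ?_
  have h : ‖(T ^ n) x‖ ^ 2 = ‖x‖ ^ 2 := by
    rw [← inner_self_eq_norm_sq (𝕜 := ℂ), inner_pow_pow_of_norm_map hinv hM n hx hx,
      inner_self_eq_norm_sq]
  exact (pow_left_inj₀ (norm_nonneg _) (norm_nonneg _) two_ne_zero).mp h

/-! ### Reducing subspaces and the conclusion -/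

/-- If `T` commutes with `T'` and agrees with it on a subspace that reduces `T'` to an isometry, then
this subspace reduces `T` to an isometry. -/
theorem IsReducingIsometric.of_commute {T T' : H →L[ℂ] H} (hT : ‖T‖ ≤ 1) (hT' : ‖T'‖ ≤ 1)
    (hcomm : Commute T T') {M : Submodule ℂ H} (hM : IsReducingIsometric T' M)
    (heq : ∀ x ∈ M, T x = T' x) : IsReducingIsometric T M := by
  obtain ⟨⟨hcl, hinv, hinv'⟩, hiso⟩ := hM
  refine ⟨⟨hcl, fun x hx => heq x hx ▸ hinv x hx, fun x hx => ?_⟩,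
    fun x hx => by rw [heq x hx, hiso x hx]⟩
  have h1 : (T†) x = (T'†) x := by
    refine ext_inner_left ℂ fun z => ?_
    have hx' : (T'†) (T' x) = x := adjoint_apply_apply_of_norm_eq hT' (hiso x hx)
    have hx'' : (T†) (T x) = x := adjoint_apply_apply_of_norm_eq hT (by rw [heq x hx, hiso x hx])
    -- Writing `x` as `T'* T' x` and as `T* T x` lets commutation exchange the two adjoints.
    calc inner ℂ z ((T†) x) = inner ℂ (T z) ((T'†) (T' x)) := by
          rw [hx', ContinuousLinearMap.adjoint_inner_right]
      _ = inner ℂ (T' z) ((T†) (T x)) := by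
          rw [ContinuousLinearMap.adjoint_inner_right, ContinuousLinearMap.adjoint_inner_right,
            heq x hx, ← mul_apply_eq_comp, ← mul_apply_eq_comp, hcomm.eq]
      _ = inner ℂ z ((T'†) x) := by rw [hx'', ContinuousLinearMap.adjoint_inner_right]
  rw [h1]
  exact hinv' x hx

theorem HarnackDominated.isReducingIsometric {T T' : H →L[ℂ] H} (h : HarnackDominated T T')
    (hT : ‖T‖ ≤ 1) (hT' : ‖T'‖ ≤ 1) (hcomm : Commute T T') :
    IsReducingIsometric T (reducingIsometricPart T') :=
  (isGreatest_reducingIsometricPart T').1.of_commute hT hT' hcomm fun _ hx =>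
    h.apply_eq_of_norm_eq hT ((isGreatest_reducingIsometricPart T').1.2 _ hx)

theorem HarnackDominated.reducingIsometricPart_le {T T' : H →L[ℂ] H} (h : HarnackDominated T T')
    (hT : ‖T‖ ≤ 1) (hT' : ‖T'‖ ≤ 1) (hcomm : Commute T T') :
    reducingIsometricPart T' ≤ reducingIsometricPart T :=
  (isGreatest_reducingIsometricPart T).2 (h.isReducingIsometric hT hT' hcomm)

theorem HarnackDominated.kernel_le {T T' : H →L[ℂ] H} (h : HarnackDominated T T')
    (hT : ‖T‖ ≤ 1) (hT' : ‖T'‖ ≤ 1) :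
    kernel (1 - asymptoticLimit T') ≤ kernel (1 - asymptoticLimit T) := by
  have heq : ∀ x ∈ kernel (1 - asymptoticLimit T'), T x = T' x := fun x hx =>
    h.apply_eq_of_norm_eq hT (norm_map_of_mem_kernel_one_sub_asymptoticLimit hT' hx)
  refine le_kernel_one_sub_asymptoticLimit hT (fun x hx => ?_) fun x hx => ?_
  · rw [heq x hx]
    exact map_mem_kernel_one_sub_asymptoticLimit hT' hx
  · rw [heq x hx, norm_map_of_mem_kernel_one_sub_asymptoticLimit hT' hx]

theorem reducingIsometricPart_le_kernel {T : H →L[ℂ] H} (hT : ‖T‖ ≤ 1) :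
    reducingIsometricPart T ≤ kernel (1 - asymptoticLimit T) :=
  le_kernel_one_sub_asymptoticLimit hT (isGreatest_reducingIsometricPart T).1.1.2.1
    (isGreatest_reducingIsometricPart T).1.2

theorem HarnackDominated.kernel_le_reducingIsometricPart {T T' : H →L[ℂ] H}
    (h : HarnackDominated T T') (hT : ‖T‖ ≤ 1) (hT' : ‖T'‖ ≤ 1) (hcomm : Commute T T')
    (hred : Reduces (kernel (1 - asymptoticLimit T)) T') :
    kernel (1 - asymptoticLimit T) ≤ reducingIsometricPart T' := by
  refine (isGreatest_reducingIsometricPart T').2 ⟨hred, fun x hx => ?_⟩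
  rw [h.eqOn_of_isometric hT hT' hcomm (fun _ => map_mem_kernel_one_sub_asymptoticLimit hT)
    hred.2.1 (fun _ => norm_map_of_mem_kernel_one_sub_asymptoticLimit hT) hx,
    norm_map_of_mem_kernel_one_sub_asymptoticLimit hT hx]

end Complete

end HarnackParts

theorem mainTheorem4 {H : Type u} [NormedAddCommGroup H] [InnerProductSpace ℂ H] [CompleteSpace H]
    (T T' : H →L[ℂ] H) (hT : ‖T‖ ≤ 1) (hT' : ‖T'‖ ≤ 1) (hcomm : T * T' = T' * T)
    (hdom : HarnackParts.HarnackDominated T T') :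
    -- part (i)
    (HarnackParts.reducingIsometricPart T' ≤ HarnackParts.reducingIsometricPart T ∧
      ∀ x ∈ HarnackParts.reducingIsometricPart T', T' x = T x) ∧
    -- part (ii)
    (HarnackParts.reducingIsometricPart T ≤ HarnackParts.kernel (HarnackParts.defect T') →
      HarnackParts.Reduces (HarnackParts.reducingIsometricPart T') T) ∧
    (HarnackParts.Reduces (HarnackParts.kernel (1 - HarnackParts.asymptoticLimit T)) T' →
      HarnackParts.reducingIsometricPart T = HarnackParts.reducingIsometricPart T' ∧
      HarnackParts.reducingIsometricPart T' =
        HarnackParts.kernel (1 - HarnackParts.asymptoticLimit T') ∧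
      HarnackParts.kernel (1 - HarnackParts.asymptoticLimit T') =
        HarnackParts.kernel (1 - HarnackParts.asymptoticLimit T)) ∧
    -- part (iii)
    (∀ (K : Type v) [NormedAddCommGroup K] [InnerProductSpace ℂ K] [CompleteSpace K]
      (K' : Type w) [NormedAddCommGroup K'] [InnerProductSpace ℂ K'] [CompleteSpace K']
      (ι : H →ₗᵢ[ℂ] K) (V : K →L[ℂ] K) (ι' : H →ₗᵢ[ℂ] K') (V' : K' →L[ℂ] K') (A : K' →L[ℂ] K),
      HarnackParts.IsMinimalIsometricDilation T ι V →
      HarnackParts.IsMinimalIsometricDilation T' ι' V' →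
      HarnackParts.IsHarnackOperator ι V ι' V' A →
      Function.Injective A →
      HarnackParts.Reduces (HarnackParts.reducingIsometricPart T') T) ∧
    -- part (iv)
    (HarnackParts.HarnackEquivalent T T' →
      HarnackParts.reducingIsometricPart T = HarnackParts.reducingIsometricPart T') := by
  have hi := hdom.reducingIsometricPart_le hT hT' hcomm
  have hred := (hdom.isReducingIsometric hT hT' hcomm).1
  refine ⟨⟨hi, fun x hx => ?_⟩, fun _ => hred, fun h => ?_, ?_, fun h => ?_⟩
  · exact (hdom.apply_eq_of_norm_eq hT
      ((HarnackParts.isGreatest_reducingIsometricPart T').1.2 x hx)).symm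
  -- The inclusions close a cycle: `H_i' ≤ N(I - S_T') ≤ N(I - S_T) ≤ H_i'`, with `H_i` between
  -- `H_i'` and `N(I - S_T)`.
  · have h1 := hdom.kernel_le_reducingIsometricPart hT hT' hcomm h
    have h2 := HarnackParts.reducingIsometricPart_le_kernel hT
    have h3 := HarnackParts.reducingIsometricPart_le_kernel hT'
    have h4 := hdom.kernel_le hT hT'
    exact ⟨le_antisymm (h2.trans h1) hi, le_antisymm h3 (h4.trans h1),
      le_antisymm h4 (h1.trans h3)⟩
  · intros
    exact hred
  · exact le_antisymm (h.2.reducingIsometricPart_le hT' hT hcomm.symm) hi
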